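/- Let $\mathbb{F}_q$ be a finite field of characteristic $p$, let $\mathfrak n$ be a finite-dimensional nilpotent associative $\mathbb{F}_q$-algebra with dual space $\mathfrak n^*$, and let $G = 1+\mathfrak n$ be the algebra group of formal sums $1+X$ ($X\in\mathfrak n$) with product $(1+X)(1+Y) = 1+X+Y+XY$. Fix a nontrivial homomorphism $\theta:\mathbb{F}_q^+\to\mathbb{C}^\times$, and for $\mu\in\mathfrak n^*$ put $\theta_\mu(g) = \theta(\mu(g-1))$ for $g \in G$. Let $\lambda\in\mathfrak n^*$. Let $\lambda^G$ be its orbit under the coadjoint action $\lambda^g(X)=\lambda(gXg^{-1})$ of $G$, and let $\psi_\lambda = |\lambda^G|^{-1/2}\sum_{\mu\in\lambda^G}\theta_\mu$ be its Kirillov function. Define subalgebras of $\mathfrak n$ by $\mathfrak l_\lambda^0=0$, $\mathfrak s_\lambda^0=\mathfrak n$ and, for $i\ge 0$, \[ \mathfrak l_\lambda^{i+1}=\{X\in\mathfrak s_\lambda^i : \lambda(XY)=0 \text{ for all } Y\in\mathfrak s_\lambda^i\},\qquad \mathfrak s_\lambda^{i+1}=\{X\in\mathfrak s_\lambda^i :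 \lambda(XY)=0 \text{ for all } Y\in\mathfrak l_\lambda^{i+1}\}. \] Let $\overline{\mathfrak l}_\lambda=\mathfrak l_\lambda^d$, where $d\ge1$ is such that $\mathfrak s_\lambda^{d-1}=\mathfrak s_\lambda^d$; this is the terminal element of the ascending chain $(\mathfrak l_\lambda^i)_{i \geq 0}$. Let $\overline L_\lambda = 1+\overline{\mathfrak l}_\lambda$ and let $\xi_\lambda=\mathrm{Ind}_{\overline L_\lambda}^G(\theta_\lambda)$ be the character of $G$ induced from the linear character $\theta_\lambda$ of $\overline L_\lambda$. For a polynomial map $\mathrm F:\mathfrak n\to G$ of the form $\mathrm F(X)=1+X+\sum_{k\ge2}a_kX^k$ with $a_k\in\mathbb{F}_q$ (such a map is a bijection), let $\psi_\lambda^{\mathrm F}:G\to\mathbb{C}$ be the function determined by $\psi_\lambda^{\mathrm F}(\mathrm F(X))=\psi_\lambda(1+X)$ for $X\in\mathfrak n$. Then for every such $\mathrm F$, if $\vartheta_1,\dots,\vartheta_m$ are the irreducible constituents of $\xi_\lambda$, there are complex numbers $c_1,\dots,c_m$ with $\psi_\lambda^{\mathrm F}=\sum_{i=1}^m c_i\vartheta_i$.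 In particular, this holds for the exponential Kirillov function $\psi_\lambda^{\mathrm{Exp}}$, where $\mathrm{Exp}(X)=\sum_{k=0}^{p-1}\frac{1}{k!}X^k$. -/

import Mathlib

/-- A non-unital associative ring `n` is nilpotent if, for some `m`, every product
`x * y₁ * ⋯ * yₘ` of `m + 1` elements vanishes, i.e. `n ^ (m + 1) = 0`. -/
class IsNilpotentRing (n : Type*) [NonUnitalRing n] : Prop where
  exists_foldl_eq_zero : ∃ m : ℕ, ∀ (x : n) (l : List n), l.length = m →
    l.foldl (fun a b => a * b) x = 0

/-- The algebra group `1 + n`: the formal sum `1 + X` is represented by `⟨X⟩`. -/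
@[ext]
structure AlgebraGroup (F n : Type*) where
  /-- `g.subOne` is the element `g - 1` of `n`. -/
  subOne : n

noncomputable section

namespace AlgebraGroup

open Polynomial

variable {F n : Type*} [Field F] [NonUnitalRing n] [Module F n]
  [IsScalarTower F n n] [SMulCommClass F n n]

section Group

theorem exists_inr_pow_eq_zero (F : Type*) {n : Type*} [Field F] [NonUnitalRing n] [Module F n]
    [IsScalarTower F n n] [SMulCommClass F n n] [IsNilpotentRing n] :
    ∃ m : ℕ, ∀ x : n, (x : Unitization F n) ^ m = 0 := by
  obtain ⟨m, hm⟩ := IsNilpotentRing.exists_foldl_eq_zero (n := n)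
  refine ⟨m + 1, fun x => ?_⟩
  have key : ∀ (k : ℕ) (y : n), (((List.replicate k x).foldl (fun a b => a * b) y : n) :
      Unitization F n) = (y : Unitization F n) * (x : Unitization F n) ^ k := by
    intro k
    induction k with
    | zero => intro y; simp
    | succ k ih => intro y; simp [List.replicate_succ, ih, pow_succ', mul_assoc]
  have h := key m x
  rw [hm x _ (by simp)] at h
  rw [pow_succ', ← h, Unitization.inr_zero]

instance : One (AlgebraGroup F n) := ⟨⟨0⟩⟩

/-- `(1 + X) * (1 + Y) = 1 + (X + Y + X * Y)`. -/
instance : Mul (AlgebraGroup F n) :=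
  ⟨fun g h => ⟨g.subOne + h.subOne + g.subOne * h.subOne⟩⟩

theorem subOne_one {F n : Type*} [NonUnitalRing n] : (1 : AlgebraGroup F n).subOne = 0 := rfl

theorem subOne_mul {F n : Type*} [NonUnitalRing n] (g h : AlgebraGroup F n) :
    (g * h).subOne = g.subOne + h.subOne + g.subOne * h.subOne := rfl

theorem exists_mul_eq_one [IsNilpotentRing n] (g : AlgebraGroup F n) :
    ∃ h : AlgebraGroup F n, h * g = 1 := by
  obtain ⟨m, hm⟩ := exists_inr_pow_eq_zero F (n := n)
  have hu : IsUnit (1 + (g.subOne : Unitization F n)) :=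
    IsNilpotent.isUnit_one_add ⟨m, hm g.subOne⟩
  obtain ⟨y, -, hy⟩ := isQuasiregular_iff.mp ((isQuasiregular_iff_isUnit' F).mpr hu)
  refine ⟨⟨y⟩, AlgebraGroup.ext ?_⟩
  rw [subOne_mul, subOne_one, ← hy]
  abel

instance [IsNilpotentRing n] : Inv (AlgebraGroup F n) :=
  ⟨fun g => (exists_mul_eq_one g).choose⟩

instance [IsNilpotentRing n] : Group (AlgebraGroup F n) :=
  Group.ofLeftAxioms
    (fun a b c => AlgebraGroup.ext (by simp only [subOne_mul, mul_add, add_mul, mul_assoc]; abel))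
    (fun a => AlgebraGroup.ext (by simp [subOne_mul, subOne_one]))
    (fun a => (exists_mul_eq_one a).choose_spec)

/-- The bijection `X ↦ 1 + X` from `n` to `1 + n`. -/
def oneAdd (F : Type*) {n : Type*} : n ≃ AlgebraGroup F n where
  toFun X := ⟨X⟩
  invFun g := g.subOne

instance [Finite F] [FiniteDimensional F n] : Finite (AlgebraGroup F n) :=
  have : Finite n := Module.finite_of_finite F
  Finite.of_equiv n (oneAdd F)

instance [Finite F] [FiniteDimensional F n] : Fintype (AlgebraGroup F n) :=
  Fintype.ofFinite _

/-- The algebra subgroup `1 + h` attached to a subalgebra `h` of `n`. -/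
def ofSubalgebra [Finite F] [FiniteDimensional F n] [IsNilpotentRing n]
    (h : NonUnitalSubalgebra F n) : Subgroup (AlgebraGroup F n) :=
  let M : Submonoid (AlgebraGroup F n) :=
    { carrier := {g | g.subOne ∈ h}
      one_mem' := h.zero_mem
      mul_mem' := fun ha hb => h.add_mem (h.add_mem ha hb) (h.mul_mem ha hb) }
  { M with
    inv_mem' := fun {g} hg => by
      have h1 : g⁻¹ ∈ Submonoid.powers g :=
        (isOfFinOrder_of_finite g).mem_powers_iff_mem_zpowers.mpr
          (Subgroup.inv_mem _ (Subgroup.mem_zpowers g))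
      exact (Submonoid.powers_le (P := M)).mpr hg h1 }

end Group

section CharacterTheory

variable {G : Type*} [Group G] [Fintype G]

/-- `⟨f, g⟩_G = |G|⁻¹ ∑ₓ f(x) * conj (g(x))`. -/
def charInner (f g : G → ℂ) : ℂ :=
  (Fintype.card G : ℂ)⁻¹ * ∑ x : G, f x * (starRingEnd ℂ) (g x)

/-- `Irr(G)`: the characters of the irreducible finite-dimensional complex representations. -/
def Irr (G : Type*) [Group G] : Set (G → ℂ) :=
  {χ | ∃ (d : ℕ) (ρ : Representation ℂ G (Fin d → ℂ)), ρ.IsIrreducible ∧ χ = ρ.character}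

open scoped ComplexOrder in
/-- `Irr(G, χ)`: the irreducible constituents of `χ`, i.e. the irreducible characters `ϑ` of `G`
such that `⟨χ, ϑ⟩_G` is a positive real number. -/
def irrConstituents (χ : G → ℂ) : Set (G → ℂ) :=
  {ϑ | ϑ ∈ Irr G ∧ 0 < charInner χ ϑ}

open scoped Classical in
/-- The function on `G` induced from (the restriction to) the subgroup `H` of the function `χ`. -/
def induced (H : Subgroup G) (χ : G → ℂ) (g : G) : ℂ :=
  (Nat.card H : ℂ)⁻¹ * ∑ x : G with x * g * x⁻¹ ∈ H, χ (x * g * x⁻¹)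

end CharacterTheory

section Kirillov

/-- The map `X ↦ g * X * g⁻¹` on `n`, where `(1 + A) * X * (1 + B) = X + A * X + X * B + A * X * B`
for `g = 1 + A` and `g⁻¹ = 1 + B`. -/
def Ad [IsNilpotentRing n] (g : AlgebraGroup F n) : n →ₗ[F] n :=
  (LinearMap.id + LinearMap.mulLeft F g.subOne) ∘ₗ
    (LinearMap.id + LinearMap.mulRight F (g⁻¹).subOne)

/-- The coadjoint action `λ^g (X) = λ(g * X * g⁻¹)`. -/
def coadjoint [IsNilpotentRing n] (lam : Module.Dual F n) (g : AlgebraGroup F n) :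
    Module.Dual F n :=
  lam ∘ₗ Ad g

open scoped Classical in
/-- The coadjoint orbit `λ^G`. -/
def coadjointOrbit [Finite F] [FiniteDimensional F n] [IsNilpotentRing n]
    (lam : Module.Dual F n) : Finset (Module.Dual F n) :=
  Finset.univ.image (coadjoint lam)

/-- The function `θ_λ(g) = θ(λ(g - 1))`. -/
def thetaFun (θ : AddChar F ℂ) (lam : Module.Dual F n) (g : AlgebraGroup F n) : ℂ :=
  θ (lam g.subOne)

/-- The Kirillov function `ψ_λ = |λ^G|^(-1/2) ∑_{μ ∈ λ^G} θ_μ`. -/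
def kirillov [Finite F] [FiniteDimensional F n] [IsNilpotentRing n]
    (θ : AddChar F ℂ) (lam : Module.Dual F n) (g : AlgebraGroup F n) : ℂ :=
  ((Real.sqrt ((coadjointOrbit lam).card : ℝ) : ℝ) : ℂ)⁻¹ *
    ∑ μ ∈ coadjointOrbit lam, thetaFun θ μ g

end Kirillov

section Xi

/-- For a subalgebra `s`, the left kernel `{X ∈ s : λ(X * Y) = 0 for all Y ∈ s}` of the form
`(X, Y) ↦ λ(X * Y)` on `s × s`. -/
def lStep (lam : Module.Dual F n) (s : NonUnitalSubalgebra F n) : NonUnitalSubalgebra F n where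
  carrier := {X | X ∈ s ∧ ∀ Y ∈ s, lam (X * Y) = 0}
  zero_mem' := ⟨s.zero_mem, fun Y _ => by simp⟩
  add_mem' := fun ha hb => ⟨s.add_mem ha.1 hb.1, fun Y hY => by
    rw [add_mul, map_add, ha.2 Y hY, hb.2 Y hY, add_zero]⟩
  smul_mem' := fun c X hX => ⟨s.toSubmodule.smul_mem c hX.1, fun Y hY => by
    rw [smul_mul_assoc, map_smul, hX.2 Y hY, smul_zero]⟩
  mul_mem' := fun ha hb => ⟨s.mul_mem ha.1 hb.1, fun Y hY => by
    rw [mul_assoc]; exact ha.2 _ (s.mul_mem hb.1 hY)⟩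

theorem mem_lStep {lam : Module.Dual F n} {s : NonUnitalSubalgebra F n} {X : n} :
    X ∈ lStep lam s ↔ X ∈ s ∧ ∀ Y ∈ s, lam (X * Y) = 0 := Iff.rfl

/-- For a subalgebra `s` with `l = lStep lam s`, the left kernel
`{X ∈ s : λ(X * Y) = 0 for all Y ∈ l}` of the form `(X, Y) ↦ λ(X * Y)` on `s × l`. -/
def sStep (lam : Module.Dual F n) (s : NonUnitalSubalgebra F n) : NonUnitalSubalgebra F n where
  carrier := {X | X ∈ s ∧ ∀ Y ∈ lStep lam s, lam (X * Y) = 0}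
  zero_mem' := ⟨s.zero_mem, fun Y _ => by simp⟩
  add_mem' := fun ha hb => ⟨s.add_mem ha.1 hb.1, fun Y hY => by
    rw [add_mul, map_add, ha.2 Y hY, hb.2 Y hY, add_zero]⟩
  smul_mem' := fun c X hX => ⟨s.toSubmodule.smul_mem c hX.1, fun Y hY => by
    rw [smul_mul_assoc, map_smul, hX.2 Y hY, smul_zero]⟩
  mul_mem' := fun {a b} ha hb => ⟨s.mul_mem ha.1 hb.1, fun Y hY => by
    rw [mul_assoc]
    rw [mem_lStep] at hY
    refine ha.2 _ (mem_lStep.mpr ⟨s.mul_mem hb.1 hY.1, fun W hW => ?_⟩)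
    rw [mul_assoc]
    refine hb.2 _ (mem_lStep.mpr ⟨s.mul_mem hY.1 hW, fun Z hZ => ?_⟩)
    rw [mul_assoc]
    exact hY.2 _ (s.mul_mem hW hZ)⟩

theorem sStep_le (lam : Module.Dual F n) (s : NonUnitalSubalgebra F n) : sStep lam s ≤ s := by
  intro X hX
  have h : X ∈ s ∧ ∀ Y ∈ lStep lam s, lam (X * Y) = 0 := hX
  exact h.1

/-- The descending chain `s_λ^0 = n`, `s_λ^(i+1) = sStep λ (s_λ^i)`. -/
def sChain (lam : Module.Dual F n) : ℕ → NonUnitalSubalgebra F n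
  | 0 => ⊤
  | i + 1 => sStep lam (sChain lam i)

/-- The ascending chain `l_λ^0 = 0`, `l_λ^(i+1) = lStep λ (s_λ^i)`. -/
def lChain (lam : Module.Dual F n) : ℕ → NonUnitalSubalgebra F n
  | 0 => ⊥
  | i + 1 => lStep lam (sChain lam i)

theorem exists_sChain_stable [Finite F] [FiniteDimensional F n] (lam : Module.Dual F n) :
    ∃ d : ℕ, 1 ≤ d ∧ sChain lam (d - 1) = sChain lam d := by
  have : Finite n := Module.finite_of_finite F
  have : Finite (NonUnitalSubalgebra F n) :=
    Finite.of_injective (fun s => (s : Set n)) SetLike.coe_injective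
  have hanti : Antitone (sChain lam) := antitone_nat_of_succ_le fun i => sStep_le lam _
  obtain ⟨i, j, hne, hij⟩ := Finite.exists_ne_map_eq_of_infinite (sChain lam)
  have main : ∀ i j : ℕ, i < j → sChain lam i = sChain lam j →
      ∃ d : ℕ, 1 ≤ d ∧ sChain lam (d - 1) = sChain lam d := by
    intro i j hlt h
    refine ⟨i + 1, by omega, le_antisymm ?_ (hanti (by omega))⟩
    rw [Nat.add_sub_cancel, h]
    exact hanti hlt
  rcases lt_or_gt_of_ne hne with h | h
  · exact main i j h hij
  · exact main j i h hij.symm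

open scoped Classical in
/-- The terminal element `l_λ^d` of the chain `l_λ^i`, where `d ≥ 1` and
`s_λ^(d-1) = s_λ^d`. -/
def lBar [Finite F] [FiniteDimensional F n] (lam : Module.Dual F n) : NonUnitalSubalgebra F n :=
  lChain lam (Nat.find (exists_sChain_stable lam))

/-- The character `ξ_λ` induced from `θ_λ` on the algebra subgroup `1 + lBar λ`. -/
def xi [Finite F] [FiniteDimensional F n] [IsNilpotentRing n]
    (θ : AddChar F ℂ) (lam : Module.Dual F n) : AlgebraGroup F n → ℂ :=
  induced (ofSubalgebra (lBar lam)) (thetaFun θ lam)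

end Xi

section PolynomialMaps

/-- For a polynomial `P` with constant term `1`, the map `X ↦ P(X)` from `n` to `1 + n`. -/
def polyMap (P : F[X]) (X : n) : AlgebraGroup F n :=
  ⟨(aeval (X : Unitization F n) P).snd⟩

/-- In the unitization of `n`, the element `polyMap P X` really is `P(X)`. -/
theorem one_add_subOne_polyMap (P : F[X]) (h0 : P.coeff 0 = 1) (X : n) :
    1 + ((polyMap P X).subOne : Unitization F n) = aeval (X : Unitization F n) P := by
  have hfst : (aeval (X : Unitization F n) P).fst = 1 := by
    have h := Polynomial.aeval_algHom_apply (Unitization.fstHom F n) (X : Unitization F n) P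
    rw [Unitization.fstHom_apply, Unitization.fstHom_apply, Unitization.fst_inr] at h
    rw [← h, ← h0, coeff_zero_eq_aeval_zero]
  refine Unitization.ext ?_ ?_
  · simp [hfst]
  · simp [polyMap]

theorem exists_comp_sub_X (Q : F[X]) (h0 : Q.coeff 0 = 0) (h1 : Q.coeff 1 = 1) (m : ℕ) :
    ∃ R : F[X], (X : F[X]) ^ m ∣ R.comp Q - X := by
  obtain ⟨U, hU⟩ : (X : F[X]) ∣ Q := X_dvd_iff.mpr h0
  have hU0 : U.coeff 0 = 1 := by rw [← h1, hU, coeff_X_mul]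
  induction m with
  | zero => exact ⟨0, by simp⟩
  | succ m ih =>
    obtain ⟨R, S, hS⟩ := ih
    refine ⟨R - C (S.coeff 0) * X ^ m, ?_⟩
    have h2 : (X : F[X]) ∣ S - C (S.coeff 0) * U ^ m := by
      rw [X_dvd_iff, coeff_sub, coeff_C_mul, coeff_zero_eq_eval_zero (U ^ m), eval_pow,
        ← coeff_zero_eq_eval_zero, hU0]
      simp
    have h3 : (R - C (S.coeff 0) * X ^ m).comp Q - X =
        X ^ m * (S - C (S.coeff 0) * U ^ m) := by
      have h4 : (R - C (S.coeff 0) * X ^ m).comp Q - X =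
          (R.comp Q - X) - C (S.coeff 0) * Q ^ m := by
        simp only [sub_comp, mul_comp, C_comp, pow_comp, X_comp]
        ring
      rw [h4, hS, hU]
      ring
    rw [h3, pow_succ]
    exact mul_dvd_mul_left _ h2

theorem polyMap_bijective [Finite F] [FiniteDimensional F n] [IsNilpotentRing n]
    (P : F[X]) (h0 : P.coeff 0 = 1) (h1 : P.coeff 1 = 1) :
    Function.Bijective (polyMap P : n → AlgebraGroup F n) := by
  have : Finite n := Module.finite_of_finite F
  have hinj : Function.Injective (polyMap P : n → AlgebraGroup F n) := by
    obtain ⟨m, hm⟩ := exists_inr_pow_eq_zero F (n := n)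
    obtain ⟨R, S, hS⟩ := exists_comp_sub_X (P - 1) (by simp [h0]) (by simp [h1, coeff_one]) m
    have hR : ∀ X : n, aeval (aeval (X : Unitization F n) P - 1) R = (X : Unitization F n) := by
      intro X
      have h := congrArg (aeval (X : Unitization F n)) hS
      simp only [map_sub, map_mul, map_pow, aeval_X, aeval_comp, map_one, hm X, zero_mul] at h
      exact sub_eq_zero.mp h
    intro X Y hXY
    have h : aeval (X : Unitization F n) P = aeval (Y : Unitization F n) P := by
      rw [← one_add_subOne_polyMap P h0, ← one_add_subOne_polyMap P h0, hXY]
    have h' : (X : Unitization F n) = (Y : Unitization F n) := by rw [← hR X, ← hR Y, h]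
    exact Unitization.inr_injective h'
  exact hinj.bijective_of_nat_card_le (Nat.card_congr (oneAdd F)).ge

/-- The bijection `n → 1 + n`, `X ↦ 1 + X + ∑_{k ≥ 2} a_k X ^ k`, given by a polynomial
with constant term `1` and linear coefficient `1`. -/
def polyEquiv [Finite F] [FiniteDimensional F n] [IsNilpotentRing n]
    (P : F[X]) (h0 : P.coeff 0 = 1) (h1 : P.coeff 1 = 1) : n ≃ AlgebraGroup F n :=
  Equiv.ofBijective (polyMap P) (polyMap_bijective P h0 h1)

/-- For a bijection `Φ : n → 1 + n` and a function `ψ` on `1 + n`, the function `ψ^Φ` determined by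
`ψ^Φ (Φ X) = ψ (1 + X)`. -/
def twist (Φ : n ≃ AlgebraGroup F n) (ψ : AlgebraGroup F n → ℂ) (g : AlgebraGroup F n) : ℂ :=
  ψ (oneAdd F (Φ.symm g))

/-- The truncated exponential polynomial `∑_{k < p} X ^ k / k!`, where `p` is the
characteristic of `F`. -/
def expPoly (F : Type*) [Field F] : F[X] :=
  ∑ k ∈ Finset.range (ringChar F), C ((k.factorial : F)⁻¹) * X ^ k

theorem coeff_expPoly (F : Type*) [Field F] [Finite F] (k : ℕ) (hk : k < 2) :
    (expPoly F).coeff k = 1 := by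
  have hp : 2 ≤ ringChar F := (CharP.char_is_prime F (ringChar F)).two_le
  have h : k < ringChar F := by omega
  have hf : k.factorial = 1 := by interval_cases k <;> rfl
  simp [expPoly, coeff_C_mul, coeff_X_pow, h, hf]

/-- The truncated exponential bijection
`Exp(X) = 1 + X + X ^ 2 / 2 + ⋯ + X ^ (p - 1) / (p - 1)!`. -/
def expEquiv [Finite F] [FiniteDimensional F n] [IsNilpotentRing n] : n ≃ AlgebraGroup F n :=
  polyEquiv (expPoly F) (coeff_expPoly F 0 (by norm_num)) (coeff_expPoly F 1 (by norm_num))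

end PolynomialMaps

end AlgebraGroup

end

/-! The function `ψ_λ^F` is a class function, because `F` intertwines `Ad` with conjugation. So it
lies in the span of the constituents of `ξ_λ` once it is orthogonal to every irreducible `χ` that is
not a constituent (`mem_span_of_charInner_eq_zero`). Let `κ` be the conjugate of such a `χ`.

Substituting `g = F(X)`, and using the invariance of `κ ∘ F` under `Ad`, all terms of the orbit sum
contribute equally. It remains to show that the sum of `θ(λ(X)) κ(F(X))` over `n` vanishes.

This sum can be shrunk from a subalgebra `s` to `sStep λ s` (`polySum_sStep`): conjugation by the
inverse of `1 + Y`, with `Y` in `l = lStep λ s`, inserts a factor `θ(λ(XY))`, and averaging over `Y`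
leaves only the `X` in `sStep λ s`. Iteration reaches a stable `s`, for which `l` is the terminal
algebra defining `ξ_λ`.

For stable `s`, `l` is a two-sided ideal of `s` and `λ` kills `ls` and `sl`. Hence in `λ(F⁻¹(hg))`,
with `h ∈ 1 + l` and `g ∈ 1 + s`, only the linear term sees `h`, and `λ(F⁻¹(hg)) = λ(h - 1) +
λ(F⁻¹(g))` (`lam_polyEquiv_symm_mul`). Averaging over `h` replaces `κ` by its `θ_λ`-twisted average
over `1 + l`. By Frobenius reciprocity that average is zero, since `χ` is not a constituent of `ξ_λ`
(`sum_conj_smul_eq_zero`). -/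

noncomputable section

namespace AlgebraGroup

/-! ### Orthogonality and completeness of irreducible characters, Frobenius reciprocity -/

section CharacterTheory

variable {G : Type*} [Group G] [Fintype G]

open Matrix in
open scoped ComplexOrder in
-- Averaging the standard Hermitian form over the group gives an invariant positive definite matrix
-- `P`, and invariance makes the adjoint of `M g` similar to `M g⁻¹` through `P`.
theorem conj_character {d : ℕ} (ρ : Representation ℂ G (Fin d → ℂ)) (g : G) :
    (starRingEnd ℂ) (ρ.character g) = ρ.character g⁻¹ := by
  classical
  set M : G → Matrix (Fin d) (Fin d) ℂ := fun x => LinearMap.toMatrix' (ρ x) with hM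
  have hmul : ∀ x y, M (x * y) = M x * M y := fun x y => by
    simp only [hM, map_mul, Module.End.mul_eq_comp, LinearMap.toMatrix'_comp]
  have hone : M 1 = 1 := by simp [hM]
  have hchar : ∀ x, ρ.character x = (M x).trace := fun x => by
    rw [Representation.character, LinearMap.trace_eq_matrix_trace ℂ (Pi.basisFun ℂ (Fin d)),
      LinearMap.toMatrix_eq_toMatrix']
  set P : Matrix (Fin d) (Fin d) ℂ := ∑ x, (M x)ᴴ * M x with hP
  have hpos : P.PosDef := by
    rw [hP, ← Finset.add_sum_erase _ _ (Finset.mem_univ 1), hone]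
    refine Matrix.PosDef.add_posSemidef (by simpa using Matrix.PosDef.one) ?_
    exact Matrix.posSemidef_sum _ fun x _ => Matrix.posSemidef_conjTranspose_mul_self _
  have hinv : (M g)ᴴ * P * M g = P := by
    rw [hP, Finset.mul_sum, Finset.sum_mul]
    refine Fintype.sum_equiv (Equiv.mulRight g) _ _ fun x => ?_
    simp only [Equiv.coe_mulRight, hmul, conjTranspose_mul, mul_assoc]
  have hdet : IsUnit P.det := (Matrix.isUnit_iff_isUnit_det _).mp hpos.isUnit
  have hstar : (M g)ᴴ = P * M g⁻¹ * P⁻¹ := by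
    have h1 : M g * M g⁻¹ = 1 := by rw [← hmul, mul_inv_cancel, hone]
    calc (M g)ᴴ = (M g)ᴴ * P * (M g * M g⁻¹) * P⁻¹ := by
          rw [h1, mul_one, mul_assoc, Matrix.mul_nonsing_inv _ hdet, mul_one]
      _ = (M g)ᴴ * P * M g * M g⁻¹ * P⁻¹ := by simp only [mul_assoc]
      _ = P * M g⁻¹ * P⁻¹ := by rw [hinv]
  rw [hchar, hchar, starRingEnd_apply, ← Matrix.trace_conjTranspose, hstar, Matrix.trace_mul_comm,
    ← mul_assoc, Matrix.nonsing_inv_mul _ hdet, one_mul]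

theorem charInner_eq_zero_of_ne {χ η : G → ℂ} (hχ : χ ∈ Irr G) (hη : η ∈ Irr G) (h : χ ≠ η) :
    charInner χ η = 0 := by
  classical
  obtain ⟨d, ρ, hρ, rfl⟩ := hχ
  obtain ⟨e, σ, hσ, rfl⟩ := hη
  have : Invertible (Nat.card G : ℂ) := invertibleOfNonzero (by simp)
  have key := Representation.char_orthonormal ρ σ
  rw [if_neg (fun ⟨f⟩ => h (Representation.char_iso f).symm)] at key
  rw [charInner]
  simp only [conj_character, Fintype.card_eq_nat_card]
  exact key

/-- The operator by which the class function `φ` acts on a representation. -/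
def classOperator {V : Type*} [AddCommGroup V] [Module ℂ V] (ρ : Representation ℂ G V)
    (φ : G → ℂ) : V →ₗ[ℂ] V :=
  ∑ g, φ g • ρ g⁻¹

theorem classOperator_apply {V : Type*} [AddCommGroup V] [Module ℂ V] (ρ : Representation ℂ G V)
    (φ : G → ℂ) (v : V) : classOperator ρ φ v = ∑ g, φ g • ρ g⁻¹ v := by
  simp [classOperator]

theorem classOperator_comm {V : Type*} [AddCommGroup V] [Module ℂ V] (ρ : Representation ℂ G V)
    {φ : G → ℂ} (hφ : ∀ g x, φ (x * g * x⁻¹) = φ g) (x : G) (v : V) :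
    classOperator ρ φ (ρ x v) = ρ x (classOperator ρ φ v) := by
  rw [classOperator_apply, classOperator_apply, map_sum]
  refine Fintype.sum_equiv (MulAut.conj x⁻¹).toEquiv _ _ fun g => ?_
  have h : φ (x⁻¹ * g * x) = φ g := by simpa using hφ g x⁻¹
  simp only [MulEquiv.toEquiv_eq_coe, EquivLike.coe_coe, MulAut.conj_apply, inv_inv, h, map_smul,
    ← Module.End.mul_apply, ← map_mul]
  congr 3
  group

theorem trace_classOperator {V : Type*} [AddCommGroup V] [Module ℂ V]
    (ρ : Representation ℂ G V) (φ : G → ℂ) :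
    LinearMap.trace ℂ V (classOperator ρ φ) = ∑ g, φ g * ρ.character g⁻¹ := by
  simp [classOperator, Representation.character]

open Representation in
-- `Irr` only mentions representations on `Fin d → ℂ`. Transport along a basis makes it usable for
-- subrepresentations.
theorem character_mem_Irr {G V : Type*} [Group G] [AddCommGroup V] [Module ℂ V]
    [FiniteDimensional ℂ V]
    (ρ : Representation ℂ G V) [hρ : ρ.IsIrreducible] : ρ.character ∈ Irr G := by
  let e : V ≃ₗ[ℂ] (Fin (Module.finrank ℂ V) → ℂ) := (Module.finBasis ℂ V).equivFun
  let σ : Representation ℂ G (Fin (Module.finrank ℂ V) → ℂ) :=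
    { toFun g := e.conj (ρ g)
      map_one' := by rw [map_one]; exact e.conj_id
      map_mul' x y := by rw [map_mul, Module.End.mul_eq_comp, LinearEquiv.conj_comp]; rfl }
  have hσ : ∀ g v, σ g (e v) = e (ρ g v) := fun g v => by
    simp [σ, LinearEquiv.conj_apply]
  refine ⟨_, σ, ?_, ?_⟩
  · have hnt : Nontrivial (Subrepresentation ρ) := hρ.toNontrivial
    refine { exists_pair_ne := ⟨⊥, ⊤, fun h => ?_⟩, eq_bot_or_eq_top := fun W => ?_ }
    · apply bot_ne_top (α := Subrepresentation ρ)
      refine SetLike.ext fun v => ⟨fun _ => trivial, fun _ => ?_⟩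
      have h1 : e v ∈ (⊥ : Subrepresentation σ) := h ▸ (trivial : e v ∈ (⊤ : Subrepresentation σ))
      have h2 : e v = 0 := h1
      have h3 : v = 0 := by simpa using h2
      exact h3
    · let U : Subrepresentation ρ :=
        ⟨W.toSubmodule.comap e.toLinearMap, fun g v hv => by
          have := W.apply_mem_toSubmodule g hv
          simpa [hσ] using this⟩
      have hU : ∀ v, v ∈ U ↔ e v ∈ W := fun v => Iff.rfl
      rcases hρ.eq_bot_or_eq_top U with h | h
      · left
        refine SetLike.ext fun w => ⟨fun hw => ?_, fun hw => ?_⟩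
        · have h1 : e.symm w ∈ U := by rw [hU, e.apply_symm_apply]; exact hw
          rw [h] at h1
          have h2 : e.symm w = 0 := h1
          have h3 : w = 0 := by simpa using h2
          exact h3
        · have h3 : w = 0 := hw
          rw [h3]
          exact W.toSubmodule.zero_mem
      · right
        refine SetLike.ext fun w => ⟨fun _ => trivial, fun _ => ?_⟩
        have h1 : e.symm w ∈ U := h ▸ trivial
        rwa [hU, e.apply_symm_apply] at h1
  · ext g
    exact (LinearMap.trace_conj' (ρ g) e).symm

/-- By Schur's lemma the operator is a scalar, and the hypothesis says that its trace is zero. -/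
theorem classOperator_eq_zero_of_isIrreducible {V : Type*} [AddCommGroup V] [Module ℂ V]
    [FiniteDimensional ℂ V] (ρ : Representation ℂ G V) [hρ : ρ.IsIrreducible]
    {φ : G → ℂ} (hφ : ∀ g x, φ (x * g * x⁻¹) = φ g)
    (h : ∑ g, φ g * ρ.character g⁻¹ = 0) : classOperator ρ φ = 0 := by
  let T : Representation.IntertwiningMap ρ ρ :=
    ⟨classOperator ρ φ, fun x => LinearMap.ext fun v => classOperator_comm ρ hφ x v⟩
  obtain ⟨c, hc⟩ :=
    (Representation.IsIrreducible.algebraMap_intertwiningMap_bijective_of_isAlgClosed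
      (ρ := ρ)).2 T
  have hT : classOperator ρ φ = c • LinearMap.id := by
    have := congrArg Representation.IntertwiningMap.toLinearMap hc
    exact this.symm
  rw [← trace_classOperator, hT, map_smul, LinearMap.trace_id, smul_eq_mul, mul_eq_zero] at h
  rcases h with h | h
  · rw [hT, h, zero_smul]
  · have : Subsingleton V := Module.finrank_zero_iff.mp (by exact_mod_cast h)
    exact Subsingleton.elim _ _

/-- Induction on dimension: by Maschke's theorem a nonzero reducible representation is the sum of
two proper subrepresentations, and the operator restricts to each. -/
theorem classOperator_eq_zero {φ : G → ℂ} (hφ : ∀ g x, φ (x * g * x⁻¹) = φ g)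
    (h : ∀ χ ∈ Irr G, ∑ g, φ g * χ g⁻¹ = 0) {V : Type*} [AddCommGroup V] [Module ℂ V]
    [FiniteDimensional ℂ V] (ρ : Representation ℂ G V) : classOperator ρ φ = 0 := by
  induction hd : Module.finrank ℂ V using Nat.strong_induction_on generalizing V with
  | _ d ih =>
  by_cases hV : Subsingleton V
  · exact Subsingleton.elim _ _
  rw [not_subsingleton_iff_nontrivial] at hV
  by_cases hirr : ρ.IsIrreducible
  · exact classOperator_eq_zero_of_isIrreducible ρ hφ (h _ (character_mem_Irr ρ))
  have hsub : ∀ W : Subrepresentation ρ, W ≠ ⊤ → ∀ v ∈ W, classOperator ρ φ v = 0 := by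
    intro W hW v hv
    have hlt : W.toSubmodule < ⊤ :=
      lt_top_iff_ne_top.mpr fun h => hW (Subrepresentation.toSubmodule_injective h)
    have h0 := ih _ (hd ▸ Submodule.finrank_lt hlt.ne) W.toRepresentation rfl
    have h1 := congrArg Subtype.val (LinearMap.congr_fun h0 ⟨v, hv⟩)
    rw [classOperator_apply] at h1 ⊢
    simpa [Subrepresentation.toRepresentation] using h1
  have hex : ∃ W : Subrepresentation ρ, W ≠ ⊥ ∧ W ≠ ⊤ := by
    by_contra hcon
    push Not at hcon
    refine hirr { exists_pair_ne := ⟨⊥, ⊤, fun h => ?_⟩, eq_bot_or_eq_top := fun W =>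
      or_iff_not_imp_left.mpr (hcon W) }
    exact bot_ne_top (α := Submodule ℂ V) (congrArg Subrepresentation.toSubmodule h)
  obtain ⟨W, hW0, hW1⟩ := hex
  have : NeZero (Nat.card G : ℂ) := ⟨by simp⟩
  have hss : Representation.IsSemisimpleRepresentation ρ := inferInstance
  obtain ⟨U, hU⟩ := hss.exists_isCompl W
  have hU1 : U ≠ ⊤ := by
    rintro rfl
    exact hW0 (by simpa using hU.inf_eq_bot)
  ext v
  have hv : v ∈ W.toSubmodule ⊔ U.toSubmodule := by
    rw [← Subrepresentation.toSubmodule_sup, hU.sup_eq_top]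
    trivial
  obtain ⟨w, hw, u, hu, rfl⟩ := Submodule.mem_sup.mp hv
  rw [map_add, hsub W hW1 w hw, hsub U hU1 u hu]
  simp

/-- Completeness: in the right regular representation, the operator attached to `φ` sends the delta
function at `1` to `φ` itself. -/
theorem eq_zero_of_charInner_eq_zero {φ : G → ℂ} (hφ : ∀ g x, φ (x * g * x⁻¹) = φ g)
    (h : ∀ χ ∈ Irr G, charInner φ χ = 0) : φ = 0 := by
  classical
  have h' : ∀ χ ∈ Irr G, ∑ g, φ g * χ g⁻¹ = 0 := by
    rintro _ ⟨d, ρ, hρ, rfl⟩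
    have := h _ ⟨d, ρ, hρ, rfl⟩
    simpa [charInner, conj_character] using this
  let R : Representation ℂ G (G → ℂ) :=
    { toFun x := LinearMap.funLeft ℂ ℂ fun y => y * x
      map_one' := by ext; simp [LinearMap.funLeft_apply]
      map_mul' x y := by
        ext f
        simp [LinearMap.funLeft_apply, mul_assoc] }
  ext g
  have h1 := congrFun (LinearMap.congr_fun (classOperator_eq_zero hφ h' R) (Pi.single 1 1)) g
  rw [classOperator_apply] at h1
  simpa [R, LinearMap.funLeft_apply, Pi.single_apply, mul_inv_eq_one] using h1

theorem exists_charInner_sub_eq_zero {G : Type*} [Fintype G] (W : Submodule ℂ (G → ℂ))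
    (φ : G → ℂ) :
    ∃ w ∈ W, ∀ u ∈ W, charInner (φ - w) u = 0 := by
  let e := WithLp.linearEquiv 2 ℂ (G → ℂ)
  let K : Submodule ℂ (EuclideanSpace ℂ G) := W.comap e.toLinearMap
  refine ⟨e (K.starProjection (e.symm φ)), K.starProjection_apply_mem _, fun u hu => ?_⟩
  have hu' : e.symm u ∈ K := by simpa [K] using hu
  have h := K.starProjection_inner_eq_zero (e.symm φ) (e.symm u) hu'
  rw [charInner, mul_eq_zero]
  right
  rw [← inner_conj_symm, map_eq_zero, PiLp.inner_apply] at h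
  rw [← h]
  refine Finset.sum_congr rfl fun x _ => ?_
  simp [e]

/-- A class function lies in the span of a set `S` of irreducible characters if it is orthogonal to
all the other ones. -/
theorem mem_span_of_charInner_eq_zero {S : Set (G → ℂ)} (hS : S ⊆ Irr G) {φ : G → ℂ}
    (hφ : ∀ g x, φ (x * g * x⁻¹) = φ g)
    (h : ∀ χ ∈ Irr G, χ ∉ S → charInner φ χ = 0) : φ ∈ Submodule.span ℂ S := by
  -- With `w` the orthogonal projection of `φ` to the span, `φ - w` is orthogonal to `S` by
  -- construction and to the other irreducibles by `h` and orthogonality, so completeness gives `φ =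
  -- w`.
  obtain ⟨w, hw, hort⟩ := exists_charInner_sub_eq_zero (Submodule.span ℂ S) φ
  have hwcl : ∀ g x, w (x * g * x⁻¹) = w g := by
    intro g x
    clear hort
    induction hw using Submodule.span_induction with
    | mem u hu =>
      obtain ⟨d, ρ, -, rfl⟩ := hS hu
      exact ρ.char_conj g x
    | zero => rfl
    | add u v _ _ hu hv => simp [hu, hv]
    | smul c u _ hu => simp [hu]
  have hwS : ∀ χ ∈ Irr G, χ ∉ S → charInner w χ = 0 := by
    intro χ hχ hχS
    clear hort hwcl
    induction hw using Submodule.span_induction with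
    | mem u hu => exact charInner_eq_zero_of_ne (hS hu) hχ fun h => hχS (h ▸ hu)
    | zero => simp [charInner]
    | add u v _ _ hu hv =>
      have := congrArg₂ (· + ·) hu hv
      simpa [charInner, add_mul, Finset.sum_add_distrib, mul_add] using this
    | smul c u _ hu =>
      have h1 : charInner (c • u) χ = c * charInner u χ := by
        simp only [charInner, Pi.smul_apply, smul_eq_mul, mul_assoc, ← Finset.mul_sum]
        exact mul_left_comm _ _ _
      rw [h1, hu, mul_zero]
  have hzero : φ - w = 0 := by
    refine eq_zero_of_charInner_eq_zero (fun g x => by simp [hφ g x, hwcl g x]) fun χ hχ => ?_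
    by_cases hχS : χ ∈ S
    · exact hort _ (Submodule.subset_span hχS)
    · have h1 := congrArg₂ (· - ·) (h χ hχ hχS) (hwS χ hχ hχS)
      simpa only [charInner, Pi.sub_apply, sub_mul, Finset.sum_sub_distrib, mul_sub,
        sub_zero] using h1
  rw [sub_eq_zero.mp hzero]
  exact hw

/-- Frobenius reciprocity. -/
theorem charInner_induced (H : Subgroup G) [Fintype H] (f : G → ℂ) {χ : G → ℂ}
    (hχ : ∀ g x, χ (x * g * x⁻¹) = χ g) :
    charInner (induced H f) χ =
      (Fintype.card H : ℂ)⁻¹ * ∑ h : H, f h * (starRingEnd ℂ) (χ h) := by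
  classical
  have hcard : (Fintype.card G : ℂ) ≠ 0 := by simp
  -- As `χ` is a class function, every conjugating element `x` in the induction formula contributes
  -- the same amount.
  have key : ∀ x : G, ∑ g : G, (if x * g * x⁻¹ ∈ H then f (x * g * x⁻¹) else 0) *
      (starRingEnd ℂ) (χ g) = ∑ h : H, f h * (starRingEnd ℂ) (χ h) := by
    intro x
    have h1 : ∑ h : H, f h * (starRingEnd ℂ) (χ h) =
        ∑ g : G, if g ∈ H then f g * (starRingEnd ℂ) (χ g) else 0 := by
      rw [← Finset.sum_filter]
      exact (Finset.sum_subtype _ (by simp) fun g => f g * (starRingEnd ℂ) (χ g)).symm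
    rw [h1]
    refine Fintype.sum_equiv (MulAut.conj x).toEquiv _ _ fun g => ?_
    simp only [MulEquiv.toEquiv_eq_coe, EquivLike.coe_coe, MulAut.conj_apply, hχ, ite_mul, zero_mul]
  simp only [charInner, induced, Finset.sum_filter]
  simp only [mul_assoc (Nat.card H : ℂ)⁻¹, ← Finset.mul_sum]
  rw [mul_left_comm, ← Fintype.card_eq_nat_card]
  congr 1
  simp only [Finset.sum_mul]
  rw [Finset.sum_comm, Finset.sum_congr rfl fun x _ => key x, Finset.sum_const, Finset.card_univ,
    nsmul_eq_mul, inv_mul_cancel_left₀ hcard]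

open scoped ComplexOrder in
/-- If `f` is multiplicative on `H` and the character of `ρ` is not a constituent of the function
induced from `f`, then the `f`-isotypic projection vanishes on `ρ`. -/
theorem sum_conj_smul_eq_zero (H : Subgroup G) [Fintype H] {f : G → ℂ}
    (hf : ∀ a ∈ H, ∀ b ∈ H, f (a * b) = f a * f b)
    {d : ℕ} (ρ : Representation ℂ G (Fin d → ℂ))
    (h : ¬ 0 < charInner (induced H f) ρ.character) :
    ∑ a : H, (starRingEnd ℂ) (f a) • ρ a = 0 := by
  have hcard : (Fintype.card H : ℂ) ≠ 0 := by simp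
  set E : (Fin d → ℂ) →ₗ[ℂ] (Fin d → ℂ) := ∑ a : H, (starRingEnd ℂ) (f a) • ρ a with hE
  have hEE : E * E = (Fintype.card H : ℂ) • E := by
    have h1 : ∀ a : H, ((starRingEnd ℂ) (f a) • ρ a) * E = E := by
      intro a
      rw [hE, Finset.mul_sum]
      refine Fintype.sum_equiv (Equiv.mulLeft a) _ _ fun b => ?_
      rw [smul_mul_smul_comm, Equiv.coe_mulLeft, Subgroup.coe_mul, hf a a.2 b b.2, map_mul, map_mul]
    calc E * E = ∑ a : H, ((starRingEnd ℂ) (f a) • ρ a) * E := by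
          rw [← Finset.sum_mul]
      _ = _ := by
          rw [Finset.sum_congr rfl fun a _ => h1 a, Finset.sum_const, Finset.card_univ,
            Nat.cast_smul_eq_nsmul]
  have hid : IsIdempotentElem ((Fintype.card H : ℂ)⁻¹ • E) := by
    rw [IsIdempotentElem, smul_mul_smul_comm, hEE, smul_smul, mul_assoc, inv_mul_cancel₀ hcard,
      mul_one]
  have htr : charInner (induced H f) ρ.character =
      (starRingEnd ℂ) (LinearMap.trace ℂ _ ((Fintype.card H : ℂ)⁻¹ • E)) := by
    rw [charInner_induced H f fun g x => ρ.char_conj g x]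
    simp [hE, Representation.character]
  -- The trace of an idempotent is its rank, a natural number. So failing to be positive forces it
  -- to be zero, and the idempotent with it.
  obtain ⟨k, hk⟩ : ∃ k : ℕ, LinearMap.trace ℂ _ ((Fintype.card H : ℂ)⁻¹ • E) = k :=
    ⟨_, (LinearMap.IsIdempotentElem.isProj_range _ hid).trace⟩
  have hk0 : k = 0 := by
    by_contra hne
    apply h
    rw [htr, hk, map_natCast]
    exact_mod_cast Nat.pos_of_ne_zero hne
  have h0 := LinearMap.IsIdempotentElem.eq_zero_of_trace_eq_zero hid (by rw [hk, hk0, Nat.cast_zero])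
  exact (smul_eq_zero.mp h0).resolve_left (inv_ne_zero hcard)

end CharacterTheory

open Polynomial

variable {F n : Type*} [Field F] [NonUnitalRing n] [Module F n]
  [IsScalarTower F n n] [SMulCommClass F n n]

/-! ### Equivariance of polynomial maps and Kirillov functions under conjugation -/

section Conjugation

variable [IsNilpotentRing n]

/-- The inclusion of `1 + n` into the unitization of `n`. -/
def toUnitization : AlgebraGroup F n →* Unitization F n where
  toFun g := 1 + (g.subOne : Unitization F n)
  map_one' := by simp [subOne_one]
  map_mul' g h := by
    simp only [subOne_mul, Unitization.inr_add, Unitization.inr_mul]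
    noncomm_ring

theorem toUnitization_apply (g : AlgebraGroup F n) :
    toUnitization g = 1 + (g.subOne : Unitization F n) := rfl

theorem toUnitization_injective : Function.Injective (toUnitization : AlgebraGroup F n → _) := by
  intro g h hgh
  exact AlgebraGroup.ext (Unitization.inr_injective (add_left_cancel hgh))

theorem Ad_apply (g : AlgebraGroup F n) (X : n) :
    Ad g X = X + X * g⁻¹.subOne + g.subOne * (X + X * g⁻¹.subOne) := by
  simp [Ad]

theorem inr_Ad (g : AlgebraGroup F n) (X : n) :
    (Ad g X : Unitization F n) = toUnitization g * X * toUnitization g⁻¹ := by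
  simp only [Ad_apply, toUnitization_apply, Unitization.inr_add, Unitization.inr_mul]
  noncomm_ring

theorem Ad_mul_apply (g h : AlgebraGroup F n) (X : n) : Ad (g * h) X = Ad g (Ad h X) := by
  refine Unitization.inr_injective (R := F) ?_
  simp only [inr_Ad, mul_inv_rev, map_mul, mul_assoc]

theorem Ad_one_apply (X : n) : Ad (1 : AlgebraGroup F n) X = X := by
  refine Unitization.inr_injective (R := F) ?_
  simp only [inr_Ad, inv_one, map_one, one_mul, mul_one]

/-- The bijection `X ↦ g * X * g⁻¹` of `n`. -/
def AdEquiv (g : AlgebraGroup F n) : n ≃ n where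
  toFun := Ad g
  invFun := Ad g⁻¹
  left_inv X := by rw [← Ad_mul_apply, inv_mul_cancel, Ad_one_apply]
  right_inv X := by rw [← Ad_mul_apply, mul_inv_cancel, Ad_one_apply]

theorem toUnitization_polyMap (P : F[X]) (h0 : P.coeff 0 = 1) (X : n) :
    toUnitization (polyMap P X) = aeval (X : Unitization F n) P :=
  one_add_subOne_polyMap P h0 X

theorem aeval_conj_of_mul_eq_one {A : Type*} [Ring A] [Algebra F A] {u v : A} (hvu : v * u = 1)
    (huv : u * v = 1) (x : A) (P : F[X]) : aeval (u * x * v) P = u * aeval x P * v := by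
  let f : A →ₐ[F] A :=
    { toFun y := u * y * v
      map_one' := by rw [mul_one, huv]
      map_mul' y z := by
        rw [show u * y * v * (u * z * v) = u * y * (v * u) * z * v by simp only [mul_assoc], hvu,
          mul_one, mul_assoc u y z]
      map_zero' := by simp
      map_add' y z := by rw [mul_add, add_mul]
      commutes' c := by rw [← Algebra.commutes, mul_assoc, huv, mul_one] }
  exact aeval_algHom_apply f x P

theorem polyMap_Ad (P : F[X]) (h0 : P.coeff 0 = 1) (g : AlgebraGroup F n) (X : n) :
    polyMap P (Ad g X) = g * polyMap P X * g⁻¹ := by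
  apply toUnitization_injective
  rw [map_mul, map_mul, toUnitization_polyMap P h0, toUnitization_polyMap P h0, inr_Ad]
  have hinv : toUnitization g⁻¹ * toUnitization g = 1 := by rw [← map_mul, inv_mul_cancel, map_one]
  have hinv' : toUnitization g * toUnitization g⁻¹ = 1 := by
    rw [← map_mul, mul_inv_cancel, map_one]
  exact aeval_conj_of_mul_eq_one hinv hinv' _ P

theorem coadjoint_coadjoint (lam : Module.Dual F n) (g h : AlgebraGroup F n) :
    coadjoint (coadjoint lam g) h = coadjoint lam (g * h) := by
  ext X
  simp [coadjoint, Ad_mul_apply]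

variable [Finite F] [FiniteDimensional F n]

theorem kirillov_Ad (θ : AddChar F ℂ) (lam : Module.Dual F n) (g : AlgebraGroup F n) (X : n) :
    kirillov θ lam (oneAdd F (Ad g X)) = kirillov θ lam (oneAdd F X) := by
  have hmem : ∀ μ ∈ coadjointOrbit lam, ∀ h, coadjoint μ h ∈ coadjointOrbit lam := by
    intro μ hμ h
    simp only [coadjointOrbit, Finset.mem_image, Finset.mem_univ, true_and] at hμ ⊢
    obtain ⟨x, rfl⟩ := hμ
    exact ⟨x * h, (coadjoint_coadjoint lam x h).symm⟩
  have hone : ∀ μ : Module.Dual F n, coadjoint μ 1 = μ := fun μ => by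
    ext X
    simp [coadjoint, Ad_one_apply]
  rw [kirillov, kirillov]
  congr 1
  refine Finset.sum_bij' (fun μ _ => coadjoint μ g) (fun μ _ => coadjoint μ g⁻¹)
    (fun μ hμ => hmem μ hμ g) (fun μ hμ => hmem μ hμ g⁻¹) (fun μ _ => ?_) (fun μ _ => ?_)
    (fun μ _ => rfl)
  · rw [coadjoint_coadjoint, mul_inv_cancel, hone]
  · rw [coadjoint_coadjoint, inv_mul_cancel, hone]

theorem polyEquiv_apply (P : F[X]) (h0 : P.coeff 0 = 1) (h1 : P.coeff 1 = 1) (X : n) :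
    polyEquiv P h0 h1 X = polyMap P X := rfl

theorem twist_kirillov_conj (P : F[X]) (h0 : P.coeff 0 = 1) (h1 : P.coeff 1 = 1)
    (θ : AddChar F ℂ) (lam : Module.Dual F n) (g x : AlgebraGroup F n) :
    twist (polyEquiv P h0 h1) (kirillov θ lam) (x * g * x⁻¹) =
      twist (polyEquiv P h0 h1) (kirillov θ lam) g := by
  obtain ⟨X, rfl⟩ := (polyEquiv P h0 h1).surjective g
  have h : x * polyEquiv P h0 h1 X * x⁻¹ = polyEquiv P h0 h1 (Ad x X) :=
    (polyMap_Ad P h0 x X).symm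
  rw [h, twist, twist, Equiv.symm_apply_apply, Equiv.symm_apply_apply, kirillov_Ad]

end Conjugation

/-! ### Polynomial inverses of polynomial maps -/

section PolynomialMaps

theorem inr_pow_succ_mem {s : NonUnitalSubalgebra F n} {X : n} (hX : X ∈ s) (k : ℕ) :
    ∃ Y ∈ s, (X : Unitization F n) ^ (k + 1) = Y := by
  induction k with
  | zero => exact ⟨X, hX, by simp⟩
  | succ k ih =>
    obtain ⟨Y, hY, h⟩ := ih
    exact ⟨Y * X, s.mul_mem hY hX, by rw [pow_succ, h, Unitization.inr_mul]⟩

theorem snd_aeval_mem {s : NonUnitalSubalgebra F n} {X : n} (hX : X ∈ s) (Q : F[X]) :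
    (aeval (X : Unitization F n) Q).snd ∈ s := by
  induction Q using Polynomial.induction_on' with
  | add p q hp hq =>
    rw [map_add, Unitization.snd_add]
    exact s.add_mem hp hq
  | monomial k a =>
    rw [aeval_monomial, ← Algebra.smul_def, Unitization.snd_smul]
    refine s.toSubmodule.smul_mem a ?_
    rcases k with _ | k
    · simp
    · obtain ⟨Y, hY, h⟩ := inr_pow_succ_mem hX k
      rw [h, Unitization.snd_inr]
      exact hY

/-- The chain rule at `0`. -/
theorem coeff_one_of_dvd_comp_sub {Q R : F[X]} (h0 : Q.coeff 0 = 0) (h1 : Q.coeff 1 = 1)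
    (h : (X : F[X]) ^ 2 ∣ R.comp Q - X) : R.coeff 1 = 1 := by
  have key : ∀ p : F[X], p.coeff 1 = p.derivative.eval 0 := fun p => by
    rw [← coeff_zero_eq_eval_zero, coeff_derivative]
    simp
  have h2 : (R.comp Q - X).coeff 1 = 0 := X_pow_dvd_iff.mp h 1 (by norm_num)
  rw [coeff_zero_eq_eval_zero] at h0
  rw [key] at h1
  rw [key, derivative_sub, derivative_comp, derivative_X, eval_sub, eval_mul, eval_comp, h0, h1,
    ← key, eval_one, one_mul, sub_eq_zero] at h2
  exact h2

theorem exists_snd_aeval_polyMap [IsNilpotentRing n] (P : F[X]) (h0 : P.coeff 0 = 1)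
    (h1 : P.coeff 1 = 1) : ∃ R : F[X], R.coeff 1 = 1 ∧
      ∀ X : n, (aeval ((polyMap P X).subOne : Unitization F n) R).snd = X := by
  obtain ⟨m, hm⟩ := exists_inr_pow_eq_zero F (n := n)
  have hQ0 : (P - 1).coeff 0 = 0 := by simp [h0]
  have hQ1 : (P - 1).coeff 1 = 1 := by simp [h1, coeff_one]
  -- The exponent `m` makes the error vanish on `n` by nilpotency; the extra `2` pins down the
  -- linear coefficient of `R`.
  obtain ⟨R, hR⟩ := exists_comp_sub_X (P - 1) hQ0 hQ1 (m + 2)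
  refine ⟨R, coeff_one_of_dvd_comp_sub hQ0 hQ1 ((pow_dvd_pow _ (by omega)).trans hR), fun X => ?_⟩
  obtain ⟨S, hS⟩ := hR
  have h := congrArg (aeval (X : Unitization F n)) hS
  simp only [map_sub, map_mul, map_pow, aeval_X, aeval_comp, map_one, pow_add, hm X, zero_mul] at h
  rw [← one_add_subOne_polyMap P h0, add_sub_cancel_left] at h
  rw [sub_eq_zero.mp h, Unitization.snd_inr]

theorem subOne_polyMap_mem_iff [IsNilpotentRing n] {s : NonUnitalSubalgebra F n} (P : F[X])
    (h0 : P.coeff 0 = 1) (h1 : P.coeff 1 = 1) (X : n) : (polyMap P X).subOne ∈ s ↔ X ∈ s := by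
  refine ⟨fun h => ?_, fun h => snd_aeval_mem h P⟩
  obtain ⟨R, -, hR⟩ := exists_snd_aeval_polyMap (n := n) P h0 h1
  rw [← hR X]
  exact snd_aeval_mem h R

end PolynomialMaps

/-! ### The kernel of a stable subalgebra as an ideal -/

section Kernels

variable {lam : Module.Dual F n} {s : NonUnitalSubalgebra F n}

theorem mem_sStep {X : n} : X ∈ sStep lam s ↔ X ∈ s ∧ ∀ Y ∈ lStep lam s, lam (X * Y) = 0 :=
  Iff.rfl

theorem mul_mem_lStep_right {X Y : n} (hX : X ∈ lStep lam s) (hY : Y ∈ s) :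
    X * Y ∈ lStep lam s :=
  ⟨s.mul_mem hX.1 hY, fun Z hZ => by rw [mul_assoc]; exact hX.2 _ (s.mul_mem hY hZ)⟩

theorem lam_mul_of_stable (hs : sStep lam s = s) {X Y : n} (hX : X ∈ s) (hY : Y ∈ lStep lam s) :
    lam (X * Y) = 0 := by
  rw [← hs] at hX
  exact hX.2 Y hY

/-- Together with `mul_mem_lStep_right`, this makes the kernel a two-sided ideal of a stable `s`. -/
theorem mul_mem_lStep_left (hs : sStep lam s = s) {X Y : n} (hX : X ∈ s)
    (hY : Y ∈ lStep lam s) : X * Y ∈ lStep lam s :=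
  ⟨s.mul_mem hX hY.1, fun Z hZ => by
    rw [mul_assoc]; exact lam_mul_of_stable hs hX (mul_mem_lStep_right hY hZ)⟩

/-- Every term of the difference contains a factor `W`, hence lies in the ideal. If the exponent is
at least `2`, it splits as a product of an element of `s` and one of the ideal, in some order, which
`λ` kills. -/
theorem add_pow_sub_pow_mem (hs : sStep lam s = s) {Z W : n} (hZ : Z ∈ s)
    (hW : W ∈ lStep lam s) (k : ℕ) : ∃ D ∈ lStep lam s,
      ((Z + W : n) : Unitization F n) ^ (k + 1) = (Z : Unitization F n) ^ (k + 1) + D ∧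
      lam D = if k = 0 then lam W else 0 := by
  induction k with
  | zero => exact ⟨W, hW, by simp, by simp⟩
  | succ k ih =>
    obtain ⟨D, hD, h, -⟩ := ih
    obtain ⟨Y, hY, hYp⟩ := inr_pow_succ_mem (F := F) hZ k
    have hZW : Z + W ∈ s := s.add_mem hZ hW.1
    refine ⟨(Z + W) * D + W * Y, (lStep lam s).add_mem (mul_mem_lStep_left hs hZW hD)
      (mul_mem_lStep_right hW hY), ?_, ?_⟩
    · rw [pow_succ', h, pow_succ' _ (k + 1), hYp]
      simp only [Unitization.inr_add, Unitization.inr_mul]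
      noncomm_ring
    · rw [map_add, lam_mul_of_stable hs hZW hD, hW.2 Y hY]
      simp

theorem lam_snd_aeval_add (hs : sStep lam s = s) {Z W : n} (hZ : Z ∈ s)
    (hW : W ∈ lStep lam s) (R : F[X]) :
    lam (aeval ((Z + W : n) : Unitization F n) R).snd =
      lam (aeval (Z : Unitization F n) R).snd + R.coeff 1 * lam W := by
  induction R using Polynomial.induction_on' with
  | add p q hp hq =>
    simp only [map_add, Unitization.snd_add, hp, hq, coeff_add]
    ring
  | monomial k a =>
    simp only [aeval_monomial, ← Algebra.smul_def, Unitization.snd_smul, map_smul, coeff_monomial]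
    rcases k with _ | k
    · simp
    · obtain ⟨D, -, h, hlam⟩ := add_pow_sub_pow_mem hs hZ hW k
      rw [h, Unitization.snd_add, map_add, Unitization.snd_inr, hlam]
      by_cases hk : k = 0 <;> simp [hk, mul_add]

open scoped Classical in
theorem sum_addChar_mul_eq_ite (θ : AddChar F ℂ) (hθ : θ ≠ 1)
    (lam : Module.Dual F n) (l : NonUnitalSubalgebra F n) [Fintype l] (X : n) :
    ∑ Y : l, θ (lam (X * Y)) = if ∀ Y ∈ l, lam (X * Y) = 0 then (Fintype.card l : ℂ) else 0 := by
  let f : l →+ F :=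
    { toFun Y := lam (X * Y)
      map_zero' := by simp
      map_add' Y Z := by simp [mul_add] }
  have h := AddChar.sum_eq_ite (θ.compAddMonoidHom f)
  have hiff : θ.compAddMonoidHom f = 0 ↔ ∀ Y ∈ l, lam (X * Y) = 0 := by
    constructor
    · intro h0 Y hY
      by_contra hne
      apply hθ
      ext c
      -- Rescaling `Y` makes `λ(XY)` equal to an arbitrary `c`, so triviality on `l` would make `θ`
      -- trivial.
      have h1 := DFunLike.congr_fun h0 (⟨(c / lam (X * Y)) • Y, l.toSubmodule.smul_mem _ hY⟩ : l)
      have h2 : θ (lam (X * (c / lam (X * Y)) • Y)) = 1 := h1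
      rwa [mul_smul_comm, map_smul, smul_eq_mul, div_mul_cancel₀ _ hne] at h2
    · intro h0
      ext Y
      simp [f, h0 Y Y.2]
  simp only [hiff] at h
  exact h

theorem Ad_mem [Finite F] [FiniteDimensional F n] [IsNilpotentRing n]
    {s : NonUnitalSubalgebra F n} {g : AlgebraGroup F n} (hg : g ∈ ofSubalgebra s)
    {X : n} (hX : X ∈ s) : Ad g X ∈ s := by
  have h : g⁻¹.subOne ∈ s := (ofSubalgebra s).inv_mem hg
  have h2 : X + X * g⁻¹.subOne ∈ s := s.add_mem hX (s.mul_mem hX h)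
  rw [Ad_apply]
  exact s.add_mem h2 (s.mul_mem hg h2)

theorem Ad_mem_iff [Finite F] [FiniteDimensional F n] [IsNilpotentRing n]
    {s : NonUnitalSubalgebra F n} {g : AlgebraGroup F n}
    (hg : g ∈ ofSubalgebra s) {X : n} : Ad g X ∈ s ↔ X ∈ s := by
  refine ⟨fun h => ?_, Ad_mem hg⟩
  have := Ad_mem ((ofSubalgebra s).inv_mem hg) h
  rwa [← Ad_mul_apply, inv_mul_cancel, Ad_one_apply] at this

theorem exists_stable_lBar [Finite F] [FiniteDimensional F n] (lam : Module.Dual F n) :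
    ∃ i, sStep lam (sChain lam i) = sChain lam i ∧ lBar lam = lStep lam (sChain lam i) := by
  classical
  obtain ⟨h1, h2⟩ := Nat.find_spec (exists_sChain_stable lam)
  obtain ⟨i, hi⟩ : ∃ i, Nat.find (exists_sChain_stable lam) = i + 1 :=
    ⟨_, (Nat.sub_add_cancel h1).symm⟩
  rw [hi, Nat.add_sub_cancel] at h2
  refine ⟨i, h2.symm, ?_⟩
  have h3 : lBar lam = lChain lam (Nat.find (exists_sChain_stable lam)) := by
    unfold lBar; congr
  rw [h3, hi, lChain]

theorem thetaFun_mul {θ : AddChar F ℂ} {g h : AlgebraGroup F n} (hg : g.subOne ∈ lStep lam s) (hh : h.subOne ∈ s) :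
    thetaFun θ lam (g * h) = thetaFun θ lam g * thetaFun θ lam h := by
  rw [thetaFun, subOne_mul, map_add, hg.2 _ hh, add_zero, map_add, AddChar.map_add_eq_mul]
  rfl

/-- The inverse of a polynomial map intertwines left translation by `1 + l` with `λ`, where `l` is
the kernel of a stable subalgebra `s`. -/
theorem lam_polyEquiv_symm_mul [Finite F] [FiniteDimensional F n] [IsNilpotentRing n]
    (hs : sStep lam s = s) (P : F[X]) (h0 : P.coeff 0 = 1) (h1 : P.coeff 1 = 1)
    {h g : AlgebraGroup F n} (hh : h.subOne ∈ lStep lam s) (hg : g.subOne ∈ s) :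
    lam ((polyEquiv P h0 h1).symm (h * g)) =
      lam h.subOne + lam ((polyEquiv P h0 h1).symm g) := by
  obtain ⟨R, hR1, hR⟩ := exists_snd_aeval_polyMap (n := n) P h0 h1
  have hsymm : ∀ x : AlgebraGroup F n,
      (polyEquiv P h0 h1).symm x = (aeval (x.subOne : Unitization F n) R).snd := by
    intro x
    obtain ⟨X, rfl⟩ := (polyEquiv P h0 h1).surjective x
    rw [Equiv.symm_apply_apply, polyEquiv_apply, hR]
  -- Left multiplication by `h` perturbs `g - 1` by an element of the ideal, on which `λ` takes the
  -- value `λ(h - 1)`.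
  have hmul : (h * g).subOne = g.subOne + (h.subOne + h.subOne * g.subOne) := by
    rw [subOne_mul]; abel
  rw [hsymm, hsymm, hmul, lam_snd_aeval_add hs hg
    ((lStep lam s).add_mem hh (mul_mem_lStep_right hh hg)), hR1, map_add lam h.subOne,
    hh.2 _ hg]
  ring

end Kernels

/-! ### Shrinking the sum along the chain, and its vanishing -/

section Sums

variable [Finite F] [FiniteDimensional F n] [IsNilpotentRing n] [Fintype n]

open scoped Classical in
/-- The sum of `θ_λ(1 + X) * κ(P(X))` over `X ∈ s`. -/
def polySum (θ : AddChar F ℂ) (lam : Module.Dual F n) (P : F[X]) (κ : AlgebraGroup F n → ℂ)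
    (s : NonUnitalSubalgebra F n) : ℂ :=
  ∑ X : n, if X ∈ s then θ (lam X) * κ (polyMap P X) else 0

/-- Conjugating by the elements of `1 + lStep λ s` and averaging turns the full sum into the part on
which the character `Y ↦ θ(λ(XY))` is trivial. -/
theorem polySum_sStep (θ : AddChar F ℂ) (hθ : θ ≠ 1) (lam : Module.Dual F n) (P : F[X])
    (h0 : P.coeff 0 = 1) {κ : AlgebraGroup F n → ℂ} (hκ : ∀ g x, κ (x * g * x⁻¹) = κ g)
    (s : NonUnitalSubalgebra F n) :
    polySum θ lam P κ (sStep lam s) = polySum θ lam P κ s := by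
  classical
  have key : ∀ Y : lStep lam s, polySum θ lam P κ s =
      ∑ X : n, if X ∈ s then θ (lam X) * κ (polyMap P X) * θ (lam (X * Y)) else 0 := by
    intro Y
    have hY : oneAdd F (Y : n) ∈ ofSubalgebra (lStep lam s) := Y.2
    -- With this inverse, `g X g⁻¹` is `(1 + A)(X + XY)` with `A` in the left kernel, so `λ` takes
    -- the value `λ(X) + λ(XY)` on it.
    set g := (oneAdd F (Y : n))⁻¹ with hg
    have hgl : g.subOne ∈ lStep lam s := (ofSubalgebra (lStep lam s)).inv_mem hY
    have hgs : g ∈ ofSubalgebra s := hgl.1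
    refine (Fintype.sum_equiv (AdEquiv g) _ _ fun X => ?_).symm
    have hAd : AdEquiv g X = Ad g X := rfl
    rw [hAd, Ad_mem_iff hgs, polyMap_Ad P h0, hκ]
    refine ite_congr rfl (fun hX => ?_) fun _ => rfl
    have hginv : g⁻¹.subOne = Y := by rw [hg, inv_inv]; rfl
    rw [Ad_apply, hginv, map_add lam (X + X * (Y : n)), hgl.2 _ (s.add_mem hX (s.mul_mem hX Y.2.1)),
      add_zero, map_add, AddChar.map_add_eq_mul]
    ring
  have hcard : (Fintype.card (lStep lam s) : ℂ) ≠ 0 := by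
    have : Nonempty (lStep lam s) := ⟨0⟩
    simp [Fintype.card_ne_zero]
  apply mul_left_cancel₀ hcard
  rw [← nsmul_eq_mul, ← nsmul_eq_mul, ← Finset.card_univ, ← Finset.sum_const, ← Finset.sum_const]
  rw [Finset.sum_congr rfl fun Y _ => key Y, Finset.sum_comm, Finset.sum_const, nsmul_eq_mul,
    polySum, Finset.mul_sum]
  refine Finset.sum_congr rfl fun X _ => ?_
  by_cases hX : X ∈ s
  · simp only [hX, if_true, ← Finset.mul_sum, sum_addChar_mul_eq_ite θ hθ, mem_sStep, true_and,
      Finset.card_univ]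
    split_ifs <;> ring
  · simp [hX, mem_sStep]

theorem polySum_sChain (θ : AddChar F ℂ) (hθ : θ ≠ 1) (lam : Module.Dual F n) (P : F[X])
    (h0 : P.coeff 0 = 1) {κ : AlgebraGroup F n → ℂ} (hκ : ∀ g x, κ (x * g * x⁻¹) = κ g) (i : ℕ) :
    polySum θ lam P κ (sChain lam i) = ∑ X : n, θ (lam X) * κ (polyMap P X) := by
  induction i with
  | zero => simp [sChain, polySum]
  | succ i ih => rw [sChain, polySum_sStep θ hθ lam P h0 hκ, ih]

/-- After passing to the group through `P`, left translation by `h` extracts the factor `θ_λ(h)`;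
summing over `h` produces the twisted sum that `hκ` annihilates. -/
theorem polySum_eq_zero (θ : AddChar F ℂ) (lam : Module.Dual F n) (P : F[X])
    (h0 : P.coeff 0 = 1) (h1 : P.coeff 1 = 1) {κ : AlgebraGroup F n → ℂ}
    {s : NonUnitalSubalgebra F n} (hs : sStep lam s = s)
    [Fintype (ofSubalgebra (lStep lam s))]
    (hκ : ∀ g, ∑ h : ofSubalgebra (lStep lam s), thetaFun θ lam h * κ (h * g) = 0) :
    polySum θ lam P κ s = 0 := by
  classical
  set Φ := polyEquiv (n := n) P h0 h1
  have hsum : polySum θ lam P κ s =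
      ∑ g : AlgebraGroup F n, if g.subOne ∈ s then θ (lam (Φ.symm g)) * κ g else 0 := by
    refine Fintype.sum_equiv Φ _ _ fun X => ?_
    have hΦ : Φ X = polyMap P X := rfl
    rw [Equiv.symm_apply_apply, hΦ, subOne_polyMap_mem_iff P h0 h1]
  have key : ∀ h : ofSubalgebra (lStep lam s), polySum θ lam P κ s =
      ∑ g : AlgebraGroup F n, (if g.subOne ∈ s then θ (lam (Φ.symm g)) else 0) *
        (thetaFun θ lam h * κ (h * g)) := by
    intro h
    rw [hsum]
    refine (Fintype.sum_equiv (Equiv.mulLeft (h : AlgebraGroup F n)) _ _ fun g => ?_).symm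
    have hh : (h : AlgebraGroup F n).subOne ∈ lStep lam s := h.2
    have hhs : (h : AlgebraGroup F n) ∈ ofSubalgebra s := hh.1
    have hmem : ((h : AlgebraGroup F n) * g).subOne ∈ s ↔ g.subOne ∈ s :=
      (ofSubalgebra s).mul_mem_cancel_left hhs
    rw [Equiv.coe_mulLeft, hmem]
    by_cases hg : g.subOne ∈ s
    · rw [if_pos hg, if_pos hg, lam_polyEquiv_symm_mul hs P h0 h1 hh hg, AddChar.map_add_eq_mul,
        thetaFun]
      ring
    · rw [if_neg hg, if_neg hg, zero_mul]
  have hcard : (Fintype.card (ofSubalgebra (lStep lam s)) : ℂ) ≠ 0 := by simp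
  apply (mul_eq_zero.mp _).resolve_left hcard
  rw [← nsmul_eq_mul, ← Finset.card_univ, ← Finset.sum_const, Finset.sum_congr rfl fun h _ => key h,
    Finset.sum_comm]
  simp only [← Finset.mul_sum, hκ, mul_zero, Finset.sum_const_zero]

end Sums

/-! ### Orthogonality to the non-constituents of `ξ_λ` -/

section Main

variable [Finite F] [FiniteDimensional F n] [IsNilpotentRing n]

theorem charInner_twist_kirillov (θ : AddChar F ℂ) (hθ : θ ≠ 1) (lam : Module.Dual F n)
    (P : F[X]) (h0 : P.coeff 0 = 1) (h1 : P.coeff 1 = 1) {χ : AlgebraGroup F n → ℂ}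
    (hχ : χ ∈ Irr (AlgebraGroup F n)) (hχ' : χ ∉ irrConstituents (xi θ lam)) :
    charInner (twist (polyEquiv P h0 h1) (kirillov θ lam)) χ = 0 := by
  classical
  have : Finite n := Module.finite_of_finite F
  have : Fintype n := Fintype.ofFinite n
  have hχ0 := hχ
  obtain ⟨d, ρ, hρ, rfl⟩ := hχ
  obtain ⟨i, hst, hl⟩ := exists_stable_lBar lam
  set κ : AlgebraGroup F n → ℂ := fun g => (starRingEnd ℂ) (ρ.character g) with hκ
  have hκc : ∀ g x, κ (x * g * x⁻¹) = κ g := fun g x => by simp only [hκ, ρ.char_conj]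
  have : Fintype (ofSubalgebra (lStep lam (sChain lam i))) := Fintype.ofFinite _
  have hproj := sum_conj_smul_eq_zero (ofSubalgebra (lStep lam (sChain lam i)))
    (f := thetaFun θ lam) (fun a ha b hb => thetaFun_mul ha (mem_lStep.mp hb).1) ρ
    (fun h => hχ' ⟨hχ0, by rw [xi, hl]; exact h⟩)
  have hκ0 : ∀ g, ∑ h : ofSubalgebra (lStep lam (sChain lam i)),
      thetaFun θ lam h * κ (h * g) = 0 := by
    intro g
    -- The conjugate trace of the vanishing projection composed with `ρ g` is the twisted sum of
    -- `κ`.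
    have h2 := congrArg (fun T => (starRingEnd ℂ) (LinearMap.trace ℂ _ (T * ρ g))) hproj
    simpa [Finset.sum_mul, hκ, Representation.character] using h2
  have hsum : ∑ X : n, θ (lam X) * κ (polyMap P X) = 0 := by
    rw [← polySum_sChain θ hθ lam P h0 hκc i]
    exact polySum_eq_zero θ lam P h0 h1 hst hκ0
  rw [charInner, mul_eq_zero]
  right
  rw [← Fintype.sum_equiv (polyEquiv P h0 h1)
    (fun X => kirillov θ lam (oneAdd F X) * κ (polyMap P X)) _ fun X => by
      rw [twist, Equiv.symm_apply_apply]; rfl]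
  simp only [kirillov, mul_assoc, ← Finset.mul_sum, Finset.sum_mul]
  rw [Finset.sum_comm, Finset.sum_eq_zero, mul_zero]
  intro μ hμ
  simp only [coadjointOrbit, Finset.mem_image, Finset.mem_univ, true_and] at hμ
  obtain ⟨g, rfl⟩ := hμ
  rw [← hsum]
  -- The orbit element is `λ ∘ Ad g`, so substituting `Ad g X` for `X` reduces its term to that of
  -- `λ`.
  refine Fintype.sum_equiv (AdEquiv g) _ _ fun X => ?_
  have hAd : AdEquiv g X = Ad g X := rfl
  rw [hAd, polyMap_Ad P h0, hκc]
  rfl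

theorem twist_kirillov_mem_span (θ : AddChar F ℂ) (hθ : θ ≠ 1) (lam : Module.Dual F n)
    (P : F[X]) (h0 : P.coeff 0 = 1) (h1 : P.coeff 1 = 1) :
    twist (polyEquiv P h0 h1) (kirillov θ lam) ∈
      Submodule.span ℂ (irrConstituents (xi θ lam)) :=
  mem_span_of_charInner_eq_zero (fun _ h => h.1) (twist_kirillov_conj P h0 h1 θ lam)
    fun _ => charInner_twist_kirillov θ hθ lam P h0 h1

end Main

end AlgebraGroup

end

theorem mainTheorem2 {F n : Type*} [Field F] [Finite F]
    [NonUnitalRing n] [Module F n] [IsScalarTower F n n] [SMulCommClass F n n]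
    [FiniteDimensional F n] [IsNilpotentRing n]
    (θ : AddChar F ℂ) (hθ : θ ≠ 1) (lam : Module.Dual F n) :
    (∀ (P : Polynomial F) (h0 : P.coeff 0 = 1) (h1 : P.coeff 1 = 1),
      AlgebraGroup.twist (AlgebraGroup.polyEquiv P h0 h1) (AlgebraGroup.kirillov θ lam) ∈
        Submodule.span ℂ (AlgebraGroup.irrConstituents (AlgebraGroup.xi θ lam))) ∧
    AlgebraGroup.twist AlgebraGroup.expEquiv (AlgebraGroup.kirillov θ lam) ∈
      Submodule.span ℂ (AlgebraGroup.irrConstituents (AlgebraGroup.xi θ lam)) :=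
  ⟨fun P h0 h1 => AlgebraGroup.twist_kirillov_mem_span θ hθ lam P h0 h1,
    AlgebraGroup.twist_kirillov_mem_span θ hθ lam _ _ _⟩
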